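/- Fix an integer $d\ge 0$ and let $Gr_d$ be the class of countable simple graphs (not necessarily connected) all of whose vertices have degree at most $d$. For $G\in Gr_d$ let $d_G$ be the graph distance ($\infty$ between different components) and $B_r(G,x)=\{y: d_G(x,y)\le r\}$. A graph $G$ of bounded degree is $D$-doubling if $|B_{2s}(G,x)|\le D\,|B_s(G,x)|$ for all $x\in V(G)$ and all integers $s\ge 1$. For $H\subseteq V(G)$ finite and non-empty, $\partial_G(H)$ is the set of vertices of $H$ that have a neighbour outside $H$, and $i_G(H)=|\partial_G(H)|/|H|$. A labeling $\varphi:V(G)\to M$ is $s$-separating if $\varphi(x)\ne\varphi(y)$ whenever $0<d_G(x,y)\le s$. Let $U_d^{n,s,M}$ be the set of rooted balls of radius $n$ with vertex degree bound $d$ equipped with an $s$-separating $M$-labeling, up to rooted labeled isomorphism. A map $\Theta:U_d^{n,s,M}\to Q$ (an oracle) and an $s$-separating $\varphi:V(G)\to M$ define the labeling $O_\Theta(\varphi):V(G)\to Q$ whose value at $x$ is $\Theta$ applied to the ball of radius $n$ around $x$ (the induced subgraph, rooted at $x$, labeled by the restriction of $\varphi$). Theorem. For every $D>1$, the class of $D$-doubling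 graphs in $Gr_d$ is distributed strongly almost finite. That is, for every $\varepsilon>0$ there exist integers $1\le s\le n$ and $N,K\ge 1$, finite sets $M,Q$ such that $|M|$ is at least the number of vertices of any rooted ball of radius $s$ and vertex degree bound $d$, and oracles $\Theta_1,\dots,\Theta_N:U_d^{n,s,M}\to Q$, such that for every $D$-doubling $G\in Gr_d$ and every $s$-separating $\varphi:V(G)\to M$, writing $H^i_x=\{z: d_G(x,z)\le K,\ O_{\Theta_i}(\varphi)(x)=O_{\Theta_i}(\varphi)(z)\}$: (1) for every $i$ and all $x,y\in V(G)$ with $O_{\Theta_i}(\varphi)(x)=O_{\Theta_i}(\varphi)(y)$, either $d_G(x,y)\le K$ or $d_G(x,y)\ge 3K$ (so the sets $H^i_x$ form a partition of $V(G)$); (2) $i_G(H^i_x)\le\varepsilon$ for every $i$ and every $x\in V(G)$; (3) for every $x\in V(G)$, $\ |\{i : x\in\partial_G(H^i_x)\}|/N\le\varepsilon$. -/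

import Mathlib

namespace QualitativeGraphs

/-- Every vertex of `G` has at most `d` neighbours. -/
def DegreeBound {V : Type} (G : SimpleGraph V) (d : ℕ) : Prop :=
  ∀ v, (G.neighborSet v).encard ≤ d

/-- The countable simple graphs of vertex degree bound `d` (not necessarily connected, finite or
infinite). -/
structure Gr (d : ℕ) where
  V : Type
  [countable : Countable V]
  graph : SimpleGraph V
  degreeBound : DegreeBound graph d

/-- The vertex set of the ball of radius `r` around `x`; `edist` is the graph distance, equal to
`⊤` for vertices in different components. -/
def ballSet {V : Type} (G : SimpleGraph V) (x : V) (r : ℕ) : Set V :=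
  {y | G.edist x y ≤ r}

/-- `φ` is `k`-separating: `φ x ≠ φ y` whenever `0 < d(x, y) ≤ k`. -/
def Separating {V Q : Type} (G : SimpleGraph V) (k : ℕ) (φ : V → Q) : Prop :=
  ∀ x y, 0 < G.edist x y → G.edist x y ≤ k → φ x ≠ φ y

/-- Rooted balls of radius `r` and vertex degree bound `d`. -/
structure RootedBall (d r : ℕ) where
  V : Type
  graph : SimpleGraph V
  root : V
  degreeBound : DegreeBound graph d
  radius : ∀ v, graph.edist root v ≤ r

/-- Rooted balls of radius `r` and vertex degree bound `d` with a `k`-separating `Q`-labeling. -/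
structure LabeledBall (d r k : ℕ) (Q : Type) extends RootedBall d r where
  label : V → Q
  separating : Separating graph k label

/-- Rooted labeled isomorphism. -/
def LabeledBall.Iso {d r k : ℕ} {Q : Type} (B C : LabeledBall d r k Q) : Prop :=
  ∃ e : B.graph ≃g C.graph, e B.root = C.root ∧ ∀ v, C.label (e v) = B.label v

instance LabeledBall.setoid (d r k : ℕ) (Q : Type) : Setoid (LabeledBall d r k Q) where
  r := LabeledBall.Iso
  iseqv :=
    { refl := fun _ => ⟨SimpleGraph.Iso.refl, rfl, fun _ => rfl⟩
      symm := by
        rintro B C ⟨e, h1, h2⟩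
        refine ⟨e.symm, ?_, fun v => ?_⟩
        · rw [← h1]; exact e.symm_apply_apply _
        · rw [← h2]; exact congrArg C.label (e.apply_symm_apply v)
      trans := by
        rintro A B C ⟨e, h1, h2⟩ ⟨f, h3, h4⟩
        refine ⟨e.trans f, ?_, fun v => ?_⟩
        · change f (e A.root) = C.root
          rw [h1, h3]
        · change C.label (f (e v)) = A.label v
          rw [h4, h2] }

/-- The set `U_d^{r,k,Q}` of `k`-separatingly `Q`-labeled rooted balls of radius `r` and vertex
degree bound `d`, up to rooted labeled isomorphism. -/
def U (d r k : ℕ) (Q : Type) : Type 1 := Quotient (LabeledBall.setoid d r k Q)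

theorem DegreeBound.induce {V : Type} {G : SimpleGraph V} {d : ℕ} (h : DegreeBound G d)
    (s : Set V) : DegreeBound (G.induce s) d := by
  intro v
  refine le_trans ?_ (h v)
  rw [← Subtype.val_injective.encard_image]
  apply Set.encard_le_encard
  rintro _ ⟨w, hw, rfl⟩
  exact hw

theorem edist_le_induce {V : Type} (G : SimpleGraph V) (s : Set V) (x y : s) :
    G.edist x y ≤ (G.induce s).edist x y := by
  by_cases h : (G.induce s).Reachable x y
  · obtain ⟨w, hw⟩ := h.exists_walk_length_eq_edist
    rw [← hw]
    have := SimpleGraph.edist_le (w.map (SimpleGraph.Embedding.induce s).toHom)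
    rwa [SimpleGraph.Walk.length_map] at this
  · rw [SimpleGraph.edist_eq_top_of_not_reachable h]
    exact le_top

theorem Separating.induce {V Q : Type} {G : SimpleGraph V} {k : ℕ} {φ : V → Q}
    (h : Separating G k φ) (s : Set V) :
    Separating (G.induce s) k (fun v : s => φ v) := by
  intro x y h1 h2
  refine h x y ?_ ((edist_le_induce G s x y).trans h2)
  rw [pos_iff_ne_zero, Ne, SimpleGraph.edist_eq_zero_iff] at h1 ⊢
  exact fun h3 => h1 (Subtype.ext h3)

theorem self_mem_ballSet {V : Type} (G : SimpleGraph V) (x : V) (r : ℕ) : x ∈ ballSet G x r := by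
  simp [ballSet]

theorem edist_induce_ballSet_le {V : Type} (G : SimpleGraph V) (x : V) (r : ℕ)
    (v : ballSet G x r) :
    (G.induce (ballSet G x r)).edist ⟨x, self_mem_ballSet G x r⟩ v ≤ r := by
  have hv : G.edist x v ≤ r := v.2
  have hr : G.Reachable x v := by
    by_contra h
    rw [SimpleGraph.edist_eq_top_of_not_reachable h] at hv
    simp at hv
  obtain ⟨w, hw⟩ := hr.exists_walk_length_eq_edist
  have hs : ∀ u ∈ w.support, u ∈ ballSet G x r := by
    classical
    intro u hu
    have h1 : G.edist x u ≤ (w.takeUntil u hu).length := SimpleGraph.edist_le _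
    have h2 : ((w.takeUntil u hu).length : ℕ∞) ≤ w.length := by
      exact_mod_cast w.length_takeUntil_le_length hu
    exact h1.trans (h2.trans (hw.le.trans hv))
  have h3 := SimpleGraph.edist_le (w.induce (ballSet G x r) hs)
  have h4 : (w.induce (ballSet G x r) hs).length = w.length := by
    conv_rhs => rw [← SimpleGraph.Walk.map_induce w hs]
    exact (SimpleGraph.Walk.length_map _ _).symm
  rw [h4] at h3
  exact h3.trans (hw.le.trans hv)

/-- The labeled rooted ball `B_r(G, x, φ)`: the subgraph of `G` induced on the ball of radius `r`
around `x`, rooted at `x` and labeled by the restriction of `φ`. -/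
def labeledBall {d : ℕ} (G : Gr d) (r : ℕ) {k : ℕ} {Q : Type} {φ : G.V → Q}
    (hφ : Separating G.graph k φ) (x : G.V) : LabeledBall d r k Q where
  V := ballSet G.graph x r
  graph := G.graph.induce (ballSet G.graph x r)
  root := ⟨x, self_mem_ballSet G.graph x r⟩
  degreeBound := G.degreeBound.induce _
  radius := edist_induce_ballSet_le G.graph x r
  label := fun v => φ v
  separating := hφ.induce _

/-- The operator `O_Θ` of the constant-time distributed algorithm with oracle `Θ`: it takes a
`k`-separating `Q₁`-labeling `φ` to the `Q₂`-labeling `x ↦ Θ(B_r(G, x, φ))`. -/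
def algorithm {d r k : ℕ} {Q₁ Q₂ : Type} (Θ : U d r k Q₁ → Q₂) (G : Gr d) {φ : G.V → Q₁}
    (hφ : Separating G.graph k φ) (x : G.V) : Q₂ :=
  Θ (Quotient.mk (LabeledBall.setoid d r k Q₁) (labeledBall G r hφ x))

/-- `M` is `(s, d)`-large: it has at least as many elements as any rooted ball of radius `s` and
vertex degree bound `d` has vertices. -/
def IsLarge (s d : ℕ) (M : Type) : Prop :=
  ∀ B : RootedBall d s, ENat.card B.V ≤ ENat.card M

/-- The (inner vertex) boundary: the vertices of `H` with a neighbour outside `H`. -/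
def boundary {V : Type} (G : SimpleGraph V) (H : Set V) : Set V :=
  {x | x ∈ H ∧ ∃ y, y ∉ H ∧ G.Adj x y}

/-- The isoperimetric constant `|∂H| / |H|` of a finite vertex set `H`. -/
noncomputable def isoperimetric {V : Type} (G : SimpleGraph V) (H : Set V) : ℝ :=
  ((boundary G H).ncard : ℝ) / (H.ncard : ℝ)

/-- The class `H_x` of `x` defined by the labeling `ψ` at scale `K`. -/
def partOf {V Q : Type} (G : SimpleGraph V) (K : ℕ) (ψ : V → Q) (x : V) : Set V :=
  {z | G.edist x z ≤ K ∧ ψ x = ψ z}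

/-- `Θ` is a distributed `(ε, K)`-partitioning oracle for the class `𝒢`. -/
def IsPartitioningOracle {d n s : ℕ} {M Q : Type} (𝒢 : Set (Gr d)) (ε : ℝ) (K : ℕ)
    (Θ : U d n s M → Q) : Prop :=
  ∀ G ∈ 𝒢, ∀ (φ : G.V → M) (hφ : Separating G.graph s φ),
    (∀ x y, algorithm Θ G hφ x = algorithm Θ G hφ y →
      G.graph.edist x y ≤ K ∨ 3 * (K : ℕ∞) ≤ G.graph.edist x y) ∧
    ∀ x, isoperimetric G.graph (partOf G.graph K (algorithm Θ G hφ) x) ≤ ε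

/-- The class `𝒢` is distributed strongly almost finite. -/
def DistributedStronglyAlmostFinite {d : ℕ} (𝒢 : Set (Gr d)) : Prop :=
  ∀ ε : ℝ, 0 < ε → ∃ s n N K : ℕ, 1 ≤ s ∧ s ≤ n ∧ 1 ≤ N ∧ 1 ≤ K ∧
    ∃ M Q : Type, Finite M ∧ Finite Q ∧ IsLarge s d M ∧
      ∃ Θ : Fin N → U d n s M → Q,
        (∀ i, IsPartitioningOracle 𝒢 ε K (Θ i)) ∧
        ∀ G ∈ 𝒢, ∀ (φ : G.V → M) (hφ : Separating G.graph s φ) (x : G.V),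
          ({i : Fin N | x ∈ boundary G.graph
              (partOf G.graph K (algorithm (Θ i) G hφ) x)}.ncard : ℝ) / (N : ℝ) ≤ ε

/-- A graph of bounded vertex degree is `D`-doubling if `|B_{2s}(x)| ≤ D |B_s(x)|` for all
vertices `x` and integers `s ≥ 1`. -/
def IsDoubling {V : Type} (D : ℝ) (G : SimpleGraph V) : Prop :=
  (∃ d : ℕ, DegreeBound G d) ∧ ∀ (x : V) (s : ℕ), 1 ≤ s →
    ((ballSet G x (2 * s)).ncard : ℝ) ≤ D * ((ballSet G x s).ncard : ℝ)

end QualitativeGraphs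

/-!
Cover the graph by the Voronoi cells of a `3k`-net, chosen greedily in the order of the labels, for
the distances `d(x, p) + σ p` with shifts `σ p < k`. The cell of `p` contains `B_k(p)` and lies in
`B_4k(p)`. A vertex on the boundary of a cell sees two centers whose shifted distances differ by at
most `2`. Charge this tie to the center with the larger label, whose shift is chosen last: by the
doubling property, every vertex ties for only boundedly many of its `k` possible shifts, uniformly
in `k`.

Hence at least half of the shifts of a center are good: they create ties on a small proportion of
the ball around it only. As cells contain balls of comparable size, letting every center use a good
shift makes the boundaries of all cells relatively small. Drawing the good shift at random, from a
seed indexed by the label of the center, makes moreover every given vertex a boundary vertex with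
probability `O(1 / k)`. The net and the shifts near a vertex are found by recursion on the finitely
many labels, hence are determined by a ball of bounded radius. There is one oracle for each value of
the seeds.
-/

namespace QualitativeGraphs

section Balls

variable {V : Type} {G : SimpleGraph V} {x y z : V} {r t u d : ℕ}

theorem mem_ballSet_comm : y ∈ ballSet G x r ↔ x ∈ ballSet G y r := by
  simp only [ballSet, Set.mem_ofPred_eq, SimpleGraph.edist_comm]

theorem mem_ballSet_trans (hy : y ∈ ballSet G x r) (hz : z ∈ ballSet G y t) (h : r + t ≤ u) :
    z ∈ ballSet G x u :=
  SimpleGraph.edist_triangle.trans ((add_le_add hy hz).trans (by exact_mod_cast h))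

theorem ballSet_subset_ballSet (hy : y ∈ ballSet G x r) (h : r + t ≤ u) :
    ballSet G y t ⊆ ballSet G x u :=
  fun _ hz => mem_ballSet_trans hy hz h

theorem ballSet_mono (h : r ≤ t) : ballSet G x r ⊆ ballSet G x t :=
  ballSet_subset_ballSet (self_mem_ballSet G x 0) (by rwa [zero_add])

theorem mem_ballSet_iff_dist : y ∈ ballSet G x r ↔ G.Reachable x y ∧ G.dist x y ≤ r := by
  refine ⟨fun h => ?_, fun ⟨hr, h⟩ => ?_⟩
  · have hr := SimpleGraph.reachable_of_edist_ne_top (ne_top_of_le_ne_top (ENat.natCast_ne_top r) h)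
    refine ⟨hr, ?_⟩
    rwa [ballSet, Set.mem_ofPred_eq, ← hr.coe_dist_eq_edist, Nat.cast_le] at h
  · rwa [ballSet, Set.mem_ofPred_eq, ← hr.coe_dist_eq_edist, Nat.cast_le]

theorem dist_le_of_mem_ballSet (h : y ∈ ballSet G x r) : G.dist x y ≤ r :=
  (mem_ballSet_iff_dist.1 h).2

theorem mem_ballSet_of_adj (hxy : G.Adj x y) : y ∈ ballSet G x 1 :=
  SimpleGraph.edist_le_one_iff_adj_or_eq.2 (Or.inl hxy)

theorem ballSet_zero : ballSet G x 0 = {x} := by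
  ext y
  simp [ballSet, eq_comm (a := x)]

theorem ballSet_succ : ballSet G x (r + 1) = ⋃ y ∈ ballSet G x r, insert y (G.neighborSet y) := by
  ext z
  simp only [Set.mem_iUnion, Set.mem_insert_iff, SimpleGraph.mem_neighborSet, exists_prop]
  constructor
  · intro hz
    obtain ⟨w, hw⟩ :=
      (mem_ballSet_iff_dist.1 (mem_ballSet_comm.1 hz)).1.exists_walk_length_eq_dist
    have hlen : w.length ≤ r + 1 := hw.trans_le (dist_le_of_mem_ballSet (mem_ballSet_comm.1 hz))
    cases w with
    | nil => exact ⟨_, self_mem_ballSet G _ r, Or.inl rfl⟩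
    | @cons _ y _ hzy w =>
      refine ⟨y, mem_ballSet_comm.1 ?_, Or.inr hzy.symm⟩
      exact (SimpleGraph.edist_le w).trans (by exact_mod_cast Nat.le_of_succ_le_succ hlen)
  · rintro ⟨y, hy, rfl | hyz⟩
    · exact ballSet_mono (Nat.le_succ r) hy
    · exact mem_ballSet_trans hy (mem_ballSet_of_adj hyz) le_rfl

theorem encard_ballSet_le (hG : DegreeBound G d) (x : V) (r : ℕ) :
    (ballSet G x r).encard ≤ ((d + 1) ^ r : ℕ) := by
  induction r with
  | zero => simp [ballSet_zero]
  | succ r ih =>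
    have hfin : (ballSet G x r).Finite := Set.finite_of_encard_le_coe ih
    have hstar (y : V) : (insert y (G.neighborSet y)).encard ≤ (d + 1 : ℕ) :=
      (Set.encard_insert_le _ _).trans (by push_cast; gcongr; exact hG y)
    calc (ballSet G x (r + 1)).encard
        = (⋃ y ∈ hfin.toFinset, insert y (G.neighborSet y)).encard := by
          simp only [ballSet_succ, Set.Finite.mem_toFinset]
      _ ≤ ∑ y ∈ hfin.toFinset, (insert y (G.neighborSet y)).encard :=
          hfin.toFinset.set_encard_biUnion_le _
      _ ≤ hfin.toFinset.card • ((d + 1 : ℕ) : ℕ∞) :=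
          Finset.sum_le_card_nsmul _ _ _ fun y _ => hstar y
      _ = (ballSet G x r).encard * (d + 1 : ℕ) := by
          rw [hfin.encard_eq_coe_toFinset_card, nsmul_eq_mul]
      _ ≤ ((d + 1) ^ (r + 1) : ℕ) := by
          rw [pow_succ, Nat.cast_mul]
          gcongr

theorem IsDoubling.finite_ballSet {D : ℝ} (hG : IsDoubling D G) (x : V) (r : ℕ) :
    (ballSet G x r).Finite :=
  let ⟨_, hd⟩ := hG.1
  Set.finite_of_encard_le_coe (encard_ballSet_le hd x r)

theorem isLarge_fin (d s : ℕ) : IsLarge s d (Fin ((d + 1) ^ s)) := by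
  intro B
  have hball : ballSet B.graph B.root s = Set.univ := Set.eq_univ_of_forall B.radius
  have hcard := encard_ballSet_le B.degreeBound B.root s
  rw [hball, Set.encard_univ] at hcard
  simpa only [ENat.card_eq_coe_fintype_card, Fintype.card_fin] using hcard

theorem Separating.mono {L : Type} {s : ℕ} {φ : V → L} (hφ : Separating G s φ) (h : r ≤ s) :
    Separating G r φ :=
  fun x y hpos hle => hφ x y hpos (hle.trans (Nat.cast_le.2 h))

theorem Separating.eq_of_label_eq {L : Type} {s : ℕ} {φ : V → L} (hφ : Separating G s φ)
    (hr : r ≤ s) (hy : y ∈ ballSet G x r) (h : φ x = φ y) : x = y := by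
  by_contra hne
  exact hφ x y (SimpleGraph.edist_pos_of_ne hne) (ballSet_mono hr hy) h

end Balls

section Counting

theorem ncard_biUnion_le_mul {ι α : Type*} {N : Set ι} (hN : N.Finite) {F : ι → Set α} {b : ℝ}
    (hF : ∀ i ∈ N, ((F i).ncard : ℝ) ≤ b) : ((⋃ i ∈ N, F i).ncard : ℝ) ≤ N.ncard * b := by
  lift N to Finset ι using hN
  calc ((⋃ i ∈ N, F i).ncard : ℝ) ≤ ∑ i ∈ N, ((F i).ncard : ℝ) :=
        mod_cast N.set_ncard_biUnion_le F
    _ ≤ N.card • b := N.sum_le_card_nsmul _ b hF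
    _ = (N : Set ι).ncard * b := by rw [nsmul_eq_mul, Set.ncard_coe_finset]

theorem mul_le_ncard_biUnion {ι α : Type*} {N : Set ι} (hN : N.Finite) {F : ι → Set α}
    (hfin : ∀ i ∈ N, (F i).Finite) (hdisj : N.PairwiseDisjoint F) {b : ℝ}
    (hF : ∀ i ∈ N, b ≤ (F i).ncard) : N.ncard * b ≤ (⋃ i ∈ N, F i).ncard := by
  rw [hN.ncard_biUnion hfin hdisj, finsum_mem_eq_finite_toFinset_sum _ hN, Nat.cast_sum,
    Set.ncard_eq_toFinset_card _ hN, ← nsmul_eq_mul]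
  exact Finset.card_nsmul_le_sum _ _ _ fun i hi => hF i (hN.mem_toFinset.1 hi)

variable {ι : Type*} [DecidableEq ι] {β : ι → Type*} [∀ i, Finite (β i)]

theorem ncard_mul_card_eq_sum_update [Fintype (∀ i, β i)] (A : Set (∀ i, β i)) (c : ι) :
    A.ncard * Nat.card (β c) = ∑ ω, {b | Function.update ω c b ∈ A}.ncard := by
  classical
  have := Fintype.ofFinite (β c)
  let swap : (∀ i, β i) × β c → (∀ i, β i) × β c := fun z => (Function.update z.1 c z.2, z.1 c)
  have hswap : Function.Involutive swap := fun z => by simp [swap]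
  calc A.ncard * Nat.card (β c) = (A ×ˢ (Set.univ : Set (β c))).ncard := by
        rw [Set.ncard_prod, Set.ncard_univ]
    _ = (swap ⁻¹' (A ×ˢ Set.univ)).ncard :=
        (Set.ncard_preimage_of_injective_subset_range hswap.injective (by
          simp [hswap.surjective.range_eq])).symm
    _ = ∑ z : (∀ i, β i) × β c, if Function.update z.1 c z.2 ∈ A then 1 else 0 := by
        rw [← Finset.card_filter, Set.ncard_eq_toFinset_card']
        congr 1
        ext z
        simp [swap]
    _ = ∑ ω, {b | Function.update ω c b ∈ A}.ncard := by
        rw [Fintype.sum_prod_type]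
        simp only [← Finset.card_filter, Set.ncard_eq_toFinset_card', Set.toFinset_ofPred]

theorem ncard_le_mul_card_of_update [Finite ι] [∀ i, Nonempty (β i)] {A : Set (∀ i, β i)}
    (c : ι) {ρ : ℝ}
    (hA : ∀ ω, ({b | Function.update ω c b ∈ A}.ncard : ℝ) ≤ ρ * Nat.card (β c)) :
    (A.ncard : ℝ) ≤ ρ * Nat.card (∀ i, β i) := by
  have := Fintype.ofFinite (∀ i, β i)
  have hpos : (0 : ℝ) < Nat.card (β c) := mod_cast Nat.card_pos
  refine le_of_mul_le_mul_right ?_ hpos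
  calc (A.ncard : ℝ) * Nat.card (β c)
      = ∑ ω, ({b | Function.update ω c b ∈ A}.ncard : ℝ) :=
        mod_cast ncard_mul_card_eq_sum_update A c
    _ ≤ Nat.card (∀ i, β i) • (ρ * Nat.card (β c)) :=
        Nat.card_eq_fintype_card (α := ∀ i, β i) ▸ Finset.sum_le_card_nsmul _ _ _ fun ω _ => hA ω
    _ = ρ * Nat.card (∀ i, β i) * Nat.card (β c) := by
        rw [nsmul_eq_mul]
        ring

/-- A choice of an element from every nonempty finite set, and an arbitrary value on the empty set.
Drawing a selector uniformly draws an element uniformly from each finite set at once, so that a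
single seed serves for a random choice from a set which is only known later. -/
abbrev Selector (α : Type*) : Type _ := ∀ S : Finset α, {t : α // S.Nonempty → t ∈ S}

namespace Selector

variable {α : Type*}

instance [Nonempty α] (S : Finset α) : Nonempty {t : α // S.Nonempty → t ∈ S} :=
  S.eq_empty_or_nonempty.elim
    (fun h => ‹Nonempty α›.map fun t => ⟨t, fun hS => absurd h hS.ne_empty⟩)
    (fun ⟨t, ht⟩ => ⟨t, fun _ => ht⟩)

theorem ncard_apply_mem_le [Finite α] {S : Finset α} (hS : S.Nonempty) (B : Set α) :
    ({s : Selector α | (s S).1 ∈ B}.ncard : ℝ) ≤ B.ncard / S.card * Nat.card (Selector α) := by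
  classical
  have : Nonempty α := hS.to_type
  refine ncard_le_mul_card_of_update S fun s => ?_
  have hcard : Nat.card {t : α // S.Nonempty → t ∈ S} = S.card := by
    simp [hS]
  have hpos : (S.card : ℝ) ≠ 0 := by
    exact_mod_cast hS.card_ne_zero
  have hB : {b : {t : α // S.Nonempty → t ∈ S} |
      Function.update s S b ∈ {s : Selector α | (s S).1 ∈ B}} = Subtype.val ⁻¹' B := by
    ext b
    simp
  rw [hcard, div_mul_cancel₀ _ hpos, hB, Nat.cast_le,
    ← Set.ncard_image_of_injective _ Subtype.val_injective]
  exact Set.ncard_le_ncard (Set.image_preimage_subset _ _)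

end Selector

end Counting

section Packing

variable {V : Type} {G : SimpleGraph V} {D : ℝ} {k R j : ℕ}

theorem IsDoubling.ncard_ballSet_mono (hG : IsDoubling D G) {x y : V} {r t : ℕ}
    (h : ballSet G x r ⊆ ballSet G y t) : ((ballSet G x r).ncard : ℝ) ≤ (ballSet G y t).ncard :=
  mod_cast Set.ncard_le_ncard h (hG.finite_ballSet y t)

theorem IsDoubling.ncard_ballSet_pos (hG : IsDoubling D G) (x : V) (r : ℕ) :
    (0 : ℝ) < (ballSet G x r).ncard :=
  mod_cast (Set.ncard_pos (hG.finite_ballSet x r)).2 ⟨x, self_mem_ballSet G x r⟩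

theorem IsDoubling.ncard_ballSet_le_pow (hG : IsDoubling D G) (hD : 0 ≤ D) (hk : 1 ≤ k) (x : V)
    (j : ℕ) : ((ballSet G x (2 ^ j * k)).ncard : ℝ) ≤ D ^ j * (ballSet G x k).ncard := by
  induction j with
  | zero => simp
  | succ j ih =>
    rw [pow_succ', pow_succ', mul_assoc, mul_assoc]
    exact (hG.2 x _ (Nat.mul_pos (by positivity) hk)).trans (by gcongr)

theorem IsDoubling.ncard_inter_ballSet_le (hG : IsDoubling D G) (hD : 0 < D) (hk : 1 ≤ k)
    {S : Set V} (hS : S.Pairwise fun p q => q ∉ ballSet G p (2 * k))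
    (hR : 2 * R + k ≤ 2 ^ j * k) (x : V) : ((S ∩ ballSet G x R).ncard : ℝ) ≤ D ^ j := by
  have hdisj : (S ∩ ballSet G x R).PairwiseDisjoint fun p => ballSet G p k := by
    intro p hp q hq hpq
    exact Set.disjoint_left.2 fun z hz hz' =>
      hS hp.1 hq.1 hpq (mem_ballSet_trans hz (mem_ballSet_comm.1 hz') (by omega))
  have hsub : ⋃ p ∈ S ∩ ballSet G x R, ballSet G p k ⊆ ballSet G x (R + k) :=
    Set.iUnion₂_subset fun p hp => ballSet_subset_ballSet hp.2 le_rfl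
  have hcmp : ∀ p ∈ S ∩ ballSet G x R,
      ((ballSet G x (R + k)).ncard : ℝ) / D ^ j ≤ (ballSet G p k).ncard := by
    intro p hp
    rw [div_le_iff₀' (by positivity)]
    exact (hG.ncard_ballSet_mono
      (ballSet_subset_ballSet (mem_ballSet_comm.1 hp.2) (by omega))).trans
      (hG.ncard_ballSet_le_pow hD.le hk p j)
  have hpos := hG.ncard_ballSet_pos x (R + k)
  refine le_of_mul_le_mul_right ?_ (div_pos hpos (pow_pos hD j))
  calc ((S ∩ ballSet G x R).ncard : ℝ) * ((ballSet G x (R + k)).ncard / D ^ j)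
      ≤ (⋃ p ∈ S ∩ ballSet G x R, ballSet G p k).ncard :=
        mul_le_ncard_biUnion ((hG.finite_ballSet x R).inter_of_right _)
          (fun p _ => hG.finite_ballSet p k) hdisj hcmp
    _ ≤ (ballSet G x (R + k)).ncard :=
        mod_cast Set.ncard_le_ncard hsub (hG.finite_ballSet x (R + k))
    _ = D ^ j * ((ballSet G x (R + k)).ncard / D ^ j) := by field_simp

end Packing

section Nets

variable {V L : Type} [LinearOrder L] {G : SimpleGraph V} {φ : V → L} {r : ℕ} {p : V}

/-- `C` is an `r`-net of `G`: its points are at mutual distance more than `r`, and every vertex is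
at distance at most `r` from one of them. -/
structure IsNet (G : SimpleGraph V) (r : ℕ) (C : Set V) : Prop where
  separated : C.Pairwise fun p q => q ∉ ballSet G p r
  covering : ∀ x, ∃ p ∈ C, p ∈ ballSet G x r

/-- Membership in the net obtained by processing the vertices in the order of their labels and
selecting each vertex that has no previously selected vertex at distance at most `r`. -/
def InGreedyNet [WellFoundedLT L] (G : SimpleGraph V) (r : ℕ) (φ : V → L) (p : V) : Prop :=
  ∀ q ∈ ballSet G p r, (_h : φ q < φ p) → ¬ InGreedyNet G r φ q
termination_by wellFounded_lt.wrap (φ p)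
decreasing_by exact _h

/-- The greedy `r`-net of `G` with respect to the labels `φ`. -/
def greedyNet [WellFoundedLT L] (G : SimpleGraph V) (r : ℕ) (φ : V → L) : Set V :=
  {p | InGreedyNet G r φ p}

theorem mem_greedyNet_iff [WellFoundedLT L] :
    p ∈ greedyNet G r φ ↔ ∀ q ∈ ballSet G p r, φ q < φ p → q ∉ greedyNet G r φ := by
  change InGreedyNet G r φ p ↔ _
  rw [InGreedyNet]
  rfl

theorem isNet_greedyNet [WellFoundedLT L] (hφ : Separating G r φ) :
    IsNet G r (greedyNet G r φ) where
  separated p hp q hq hpq hball := by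
    rcases lt_trichotomy (φ p) (φ q) with h | h | h
    · exact mem_greedyNet_iff.1 hq p (mem_ballSet_comm.1 hball) h hp
    · exact hpq (hφ.eq_of_label_eq le_rfl hball h)
    · exact mem_greedyNet_iff.1 hp q hball h hq
  covering x := by
    by_cases hx : x ∈ greedyNet G r φ
    · exact ⟨x, hx, self_mem_ballSet G x r⟩
    · rw [mem_greedyNet_iff] at hx
      push Not at hx
      obtain ⟨q, hball, -, hq⟩ := hx
      exact ⟨q, hq, hball⟩

end Nets

section Cells

variable {V L : Type} [LinearOrder L]

/-- The vertices owned by the center `p`: those `x` for which `p` minimizes the shifted distance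
`d(x, q) + σ q` among the centers `q ∈ C` at distance at most `4 * k`, ties being broken in favour
of the smaller label. -/
def cell (G : SimpleGraph V) (k : ℕ) (C : Set V) (σ : V → ℕ) (φ : V → L) (p : V) : Set V :=
  {x | p ∈ C ∩ ballSet G x (4 * k) ∧
    ∀ q ∈ C ∩ ballSet G x (4 * k),
      toLex (G.dist x p + σ p, φ p) ≤ toLex (G.dist x q + σ q, φ q)}

/-- The label of the center owning `x`, encoded as a set so as to be defined without assuming that
there is exactly one owner. -/
def cellLabel (G : SimpleGraph V) (k : ℕ) (C : Set V) (σ : V → ℕ) (φ : V → L) (x : V) : Set L :=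
  φ '' {p | x ∈ cell G k C σ φ p}

/-- The vertices near `p` whose distance to `p` shifted by `t` ties, up to an error of `2`, with
their shifted distance to some center `q ∈ E`. -/
def conflict (G : SimpleGraph V) (k : ℕ) (E : Set V) (σ : V → ℕ) (p : V) (t : ℕ) : Set V :=
  {x ∈ ballSet G p (4 * k) | ∃ q ∈ E, q ∈ ballSet G x (4 * k) ∧
    G.dist x p + t ≤ G.dist x q + σ q + 2 ∧ G.dist x q + σ q ≤ G.dist x p + t + 2}

/-- The centers processed before `p`. -/
def earlierCenters (C : Set V) (φ : V → L) (p : V) : Set V :=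
  {q ∈ C | φ q < φ p}

/-- The vertices near the center `c` which tie with an earlier center under the shifts `σ`. -/
def centerConflict (G : SimpleGraph V) (k : ℕ) (C : Set V) (σ : V → ℕ) (φ : V → L) (c : V) :
    Set V :=
  conflict G k (earlierCenters C φ c) σ c (σ c)

variable {G : SimpleGraph V} {k : ℕ} {C : Set V} {σ : V → ℕ} {φ : V → L} {x y p q : V}

theorem earlierCenters_subset (φ : V → L) (p : V) : earlierCenters C φ p ⊆ C :=
  Set.sep_subset _ _

theorem dist_add_le_of_mem_cell (hx : x ∈ cell G k C σ φ p) (hq : q ∈ C)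
    (hball : q ∈ ballSet G x (4 * k)) : G.dist x p + σ p ≤ G.dist x q + σ q :=
  Prod.Lex.monotone_fst _ _ (hx.2 q ⟨hq, hball⟩)

theorem exists_mem_cell [WellFoundedLT L] (hC : IsNet G (3 * k) C) (x : V) :
    ∃ p, x ∈ cell G k C σ φ p := by
  obtain ⟨p, hp, hball⟩ := hC.covering x
  obtain ⟨q, hq⟩ := exists_minimalFor_of_wellFoundedLT (· ∈ C ∩ ballSet G x (4 * k))
    (fun q => toLex (G.dist x q + σ q, φ q)) ⟨p, hp, ballSet_mono (by omega) hball⟩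
  exact ⟨q, hq.1, fun z hz => (le_total _ _).elim id (hq.2 hz)⟩

theorem eq_of_mem_cell (hφ : Separating G (32 * k) φ) (hp : x ∈ cell G k C σ φ p)
    (hq : x ∈ cell G k C σ φ q) : p = q := by
  have hlex := toLex_inj.1 ((hp.2 q hq.1).antisymm (hq.2 p hp.1))
  exact hφ.eq_of_label_eq (r := 8 * k) (by omega)
    (mem_ballSet_trans (mem_ballSet_comm.1 hp.1.2) hq.1.2 (by omega)) (Prod.mk.inj hlex).2

theorem dist_add_lt_of_mem_cell (hC : IsNet G (3 * k) C) (hσ : ∀ p, σ p < k)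
    (hx : x ∈ cell G k C σ φ p) : G.dist x p + σ p < 4 * k := by
  obtain ⟨q, hq, hball⟩ := hC.covering x
  have hle := dist_add_le_of_mem_cell hx hq (ballSet_mono (by omega) hball)
  have hdist := dist_le_of_mem_ballSet hball
  have hshift := hσ q
  omega

theorem ballSet_subset_cell (hC : IsNet G (3 * k) C) (hσ : ∀ p, σ p < k) (hp : p ∈ C) :
    ballSet G p k ⊆ cell G k C σ φ p := by
  intro x hx
  have hxp := mem_ballSet_comm.1 hx
  refine ⟨⟨hp, ballSet_mono (by omega) hxp⟩, fun q ⟨hq, hball⟩ => ?_⟩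
  obtain rfl | hne := eq_or_ne p q
  · exact le_rfl
  have hfar : ¬ G.dist x q ≤ 2 * k := fun h => hC.separated hp hq hne
    (mem_ballSet_trans hx (mem_ballSet_iff_dist.2 ⟨(mem_ballSet_iff_dist.1 hball).1, h⟩) (by omega))
  have hnear := dist_le_of_mem_ballSet hxp
  have hshift := hσ p
  exact (Prod.Lex.toLex_lt_toLex.2 (Or.inl (by omega))).le

theorem dist_le_dist_add_one_of_adj (hxy : G.Adj x y) (p : V) :
    G.dist y p ≤ G.dist x p + 1 := by
  have htri := hxy.symm.reachable.dist_triangle_left p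
  rwa [SimpleGraph.dist_eq_one_iff_adj.2 hxy.symm, add_comm] at htri

/-- Crossing the edge from `x` to its neighbour in the cell of `q` changes distances by at most `1`,
so that the shifted distances from `x` to the two owners differ by at most `2`. -/
theorem exists_mem_centerConflict_of_mem_boundary [WellFoundedLT L] (hC : IsNet G (3 * k) C)
    (hσ : ∀ p, σ p < k) (hφ : Separating G (32 * k) φ)
    (hx : x ∈ boundary G (cell G k C σ φ p)) :
    ∃ c ∈ C, x ∈ centerConflict G k C σ φ c := by
  obtain ⟨hxp, y, hyp, hxy⟩ := hx
  obtain ⟨q, hyq⟩ := exists_mem_cell (σ := σ) (φ := φ) hC y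
  have hpq : p ≠ q := fun h => hyp (h ▸ hyq)
  have hxp_lt := dist_add_lt_of_mem_cell hC hσ hxp
  have hyq_lt := dist_add_lt_of_mem_cell hC hσ hyq
  have hdp := dist_le_dist_add_one_of_adj hxy p
  have hdq := dist_le_dist_add_one_of_adj hxy.symm q
  obtain ⟨⟨hp, hpx⟩, -⟩ := id hxp
  obtain ⟨⟨hq, hqy⟩, -⟩ := id hyq
  have hqx : q ∈ ballSet G x (4 * k) := mem_ballSet_iff_dist.2
    ⟨hxy.reachable.trans (mem_ballSet_iff_dist.1 hqy).1, by omega⟩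
  have hpy : p ∈ ballSet G y (4 * k) := mem_ballSet_iff_dist.2
    ⟨hxy.symm.reachable.trans (mem_ballSet_iff_dist.1 hpx).1, by omega⟩
  have hle_x := dist_add_le_of_mem_cell hxp hq hqx
  have hle_y := dist_add_le_of_mem_cell hyq hp hpy
  rcases lt_trichotomy (φ p) (φ q) with h | h | h
  · exact ⟨q, hq, mem_ballSet_comm.1 hqx, p, ⟨hp, h⟩, hpx, by omega, by omega⟩
  · exact absurd (hφ.eq_of_label_eq (r := 8 * k) (by omega)
      (mem_ballSet_trans (mem_ballSet_comm.1 hpx) hqx (by omega)) h) hpq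
  · exact ⟨p, hp, mem_ballSet_comm.1 hpx, q, ⟨hq, h⟩, hqx, by omega, by omega⟩

theorem cellLabel_eq_singleton (hφ : Separating G (32 * k) φ) (hx : x ∈ cell G k C σ φ p) :
    cellLabel G k C σ φ x = {φ p} := by
  have : {q | x ∈ cell G k C σ φ q} = {p} :=
    Set.eq_singleton_iff_unique_mem.2 ⟨hx, fun q hq => eq_of_mem_cell hφ hq hx⟩
  rw [cellLabel, this, Set.image_singleton]

theorem mem_ballSet_of_mem_cell (hx : x ∈ cell G k C σ φ p) (hy : y ∈ cell G k C σ φ p) :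
    y ∈ ballSet G x (8 * k) :=
  mem_ballSet_trans hx.1.2 (mem_ballSet_comm.1 hy.1.2) (by omega)

/-- Centers with the same label are at distance more than `32 * k`, and every vertex is at distance
at most `4 * k` from the owner of its cell. -/
theorem mem_cell_of_cellLabel_eq [WellFoundedLT L] (hC : IsNet G (3 * k) C)
    (hφ : Separating G (32 * k) φ) (hx : x ∈ cell G k C σ φ p) (hy : y ∈ ballSet G x (24 * k))
    (h : cellLabel G k C σ φ x = cellLabel G k C σ φ y) : y ∈ cell G k C σ φ p := by
  obtain ⟨q, hq⟩ := exists_mem_cell (σ := σ) (φ := φ) hC y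
  rw [cellLabel_eq_singleton hφ hx, cellLabel_eq_singleton hφ hq, Set.singleton_eq_singleton_iff]
    at h
  have hpy : y ∈ ballSet G p (28 * k) :=
    mem_ballSet_trans (mem_ballSet_comm.1 hx.1.2) hy (by omega)
  rwa [hφ.eq_of_label_eq le_rfl (mem_ballSet_trans hpy hq.1.2 (by omega)) h]

theorem partOf_cellLabel_eq [WellFoundedLT L] (hC : IsNet G (3 * k) C)
    (hφ : Separating G (32 * k) φ) (hx : x ∈ cell G k C σ φ p) :
    partOf G (8 * k) (cellLabel G k C σ φ) x = cell G k C σ φ p := by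
  ext y
  refine ⟨fun ⟨hball, hlabel⟩ =>
    mem_cell_of_cellLabel_eq hC hφ hx (ballSet_mono (by omega) hball) hlabel, fun hy => ?_⟩
  refine ⟨mem_ballSet_of_mem_cell hx hy, ?_⟩
  rw [cellLabel_eq_singleton hφ hx, cellLabel_eq_singleton hφ hy]

theorem edist_le_or_le_of_cellLabel_eq [WellFoundedLT L] (hC : IsNet G (3 * k) C)
    (hφ : Separating G (32 * k) φ) (h : cellLabel G k C σ φ x = cellLabel G k C σ φ y) :
    G.edist x y ≤ (8 * k : ℕ) ∨ 3 * ((8 * k : ℕ) : ℕ∞) ≤ G.edist x y := by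
  obtain ⟨p, hp⟩ := exists_mem_cell (σ := σ) (φ := φ) hC x
  refine or_iff_not_imp_right.2 fun hfar => mem_ballSet_of_mem_cell hp
    (mem_cell_of_cellLabel_eq hC hφ hp ?_ h)
  have hnear := (not_le.1 hfar).le
  rwa [show 3 * ((8 * k : ℕ) : ℕ∞) = (24 * k : ℕ) by push_cast; ring] at hnear

end Cells

section Shifts

variable {V L : Type} [LinearOrder L] {G : SimpleGraph V} {k : ℕ} {δ D : ℝ} {C E : Set V}
  {σ τ : V → ℕ} {φ : V → L} {p : V}

/-- The shifts for which the center `p` ties with the centers `E` on at most a proportion `δ` of the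
ball of radius `4 * k` around it. -/
noncomputable def goodShifts (G : SimpleGraph V) (k : ℕ) (δ : ℝ) (E : Set V) (σ : V → ℕ) (p : V) :
    Finset (Fin k) :=
  open Classical in {t | (conflict G k E σ p t).ncard ≤ δ * (ballSet G p (4 * k)).ncard}

theorem conflict_congr (h : Set.EqOn σ τ E) (t : ℕ) :
    conflict G k E σ p t = conflict G k E τ p t := by
  ext x
  refine and_congr_right fun _ => exists_congr fun q => and_congr_right fun hq => ?_
  rw [h hq]

theorem goodShifts_congr (h : Set.EqOn σ τ E) :
    goodShifts G k δ E σ p = goodShifts G k δ E τ p := by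
  simp only [goodShifts, conflict_congr h]

theorem ncard_window_le (k a b : ℕ) :
    {t : Fin k | a + t ≤ b + 2 ∧ b ≤ a + t + 2}.ncard ≤ 5 := by
  rw [← Set.ncard_image_of_injective _ Fin.val_injective]
  calc _ ≤ (Finset.Icc (b - 2 - a) (b + 2 - a) : Set ℕ).ncard := by
        refine Set.ncard_le_ncard ?_ (Finset.finite_toSet _)
        rintro _ ⟨t, ⟨h₁, h₂⟩, rfl⟩
        simp only [Finset.coe_Icc, Set.mem_Icc]
        omega
    _ ≤ 5 := by
        rw [Set.ncard_coe_finset, Nat.card_Icc]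
        omega

theorem IsDoubling.ncard_conflict_shifts_le (hG : IsDoubling D G) (hD : 0 < D) (hk : 1 ≤ k)
    (hE : E.Pairwise fun p q => q ∉ ballSet G p (2 * k)) (p x : V) :
    ({t : Fin k | x ∈ conflict G k E σ p t}.ncard : ℝ) ≤ 5 * D ^ 4 := by
  have hsub : {t : Fin k | x ∈ conflict G k E σ p t} ⊆ ⋃ q ∈ E ∩ ballSet G x (4 * k),
      {t : Fin k | G.dist x p + t ≤ G.dist x q + σ q + 2 ∧ G.dist x q + σ q ≤ G.dist x p + t + 2} :=
    fun t ⟨_, q, hq, hball, ht⟩ => Set.mem_biUnion ⟨hq, hball⟩ ht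
  calc ({t : Fin k | x ∈ conflict G k E σ p t}.ncard : ℝ)
      ≤ _ := mod_cast Set.ncard_le_ncard hsub
    _ ≤ (E ∩ ballSet G x (4 * k)).ncard * 5 :=
        ncard_biUnion_le_mul ((hG.finite_ballSet x _).inter_of_right _)
          fun q _ => mod_cast ncard_window_le k _ _
    _ ≤ 5 * D ^ 4 := by
        rw [mul_comm]
        gcongr
        exact hG.ncard_inter_ballSet_le hD hk hE (by omega) x

/-- On average over the shifts, a vertex is in conflict for at most `5 * D ^ 4` of the `k` shifts,
so Markov's inequality bounds the number of bad shifts. -/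
theorem IsDoubling.le_two_mul_card_goodShifts (hG : IsDoubling D G) (hD : 0 < D) (hk : 1 ≤ k)
    (hE : E.Pairwise fun p q => q ∉ ballSet G p (2 * k)) (hδ : 0 < δ) (hkδ : 10 * D ^ 4 ≤ δ * k)
    (σ : V → ℕ) (p : V) : (k : ℝ) ≤ 2 * (goodShifts G k δ E σ p).card := by
  classical
  set S := goodShifts G k δ E σ p with hS
  have hfin := hG.finite_ballSet p (4 * k)
  have hbad : (Sᶜ.card : ℝ) * (δ * (ballSet G p (4 * k)).ncard) ≤
      (ballSet G p (4 * k)).ncard * (5 * D ^ 4) := by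
    rw [Set.ncard_eq_toFinset_card _ hfin, ← nsmul_eq_mul, ← nsmul_eq_mul]
    refine Finset.card_nsmul_le_card_nsmul (fun (t : Fin k) x => x ∈ conflict G k E σ p t)
      (fun t ht => ?_) fun x _ => ?_
    · rw [hS, goodShifts, Finset.compl_filter, Finset.mem_filter_univ, not_le,
        Set.ncard_eq_toFinset_card _ hfin] at ht
      refine ht.le.trans ?_
      rw [← Set.ncard_coe_finset, Nat.cast_le]
      refine Set.ncard_le_ncard (fun x hx => ?_) (Finset.finite_toSet _)
      exact Finset.mem_coe.2 ((Finset.mem_bipartiteAbove _).2 ⟨hfin.mem_toFinset.2 hx.1, hx⟩)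
    · refine le_trans ?_ (hG.ncard_conflict_shifts_le (σ := σ) hD hk hE p x)
      rw [← Set.ncard_coe_finset, Nat.cast_le]
      exact Set.ncard_le_ncard fun t ht => ((Finset.mem_bipartiteBelow _).1 ht).2
  have hpos := hG.ncard_ballSet_pos p (4 * k)
  have hbad' : Sᶜ.card * δ ≤ 5 * D ^ 4 :=
    le_of_mul_le_mul_right (by linarith) hpos
  have hsum : (S.card : ℝ) + Sᶜ.card = k := by
    exact_mod_cast (S.card_add_card_compl).trans (Fintype.card_fin k)
  have : Sᶜ.card * δ ≤ k / 2 * δ := by linarith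
  have := le_of_mul_le_mul_right this hδ
  linarith

theorem IsDoubling.goodShifts_nonempty (hG : IsDoubling D G) (hD : 0 < D) (hk : 1 ≤ k)
    (hE : E.Pairwise fun p q => q ∉ ballSet G p (2 * k)) (hδ : 0 < δ) (hkδ : 10 * D ^ 4 ≤ δ * k)
    (σ : V → ℕ) (p : V) : (goodShifts G k δ E σ p).Nonempty := by
  have hcard := hG.le_two_mul_card_goodShifts hD hk hE hδ hkδ σ p
  rw [← Finset.card_pos]
  have : (1 : ℝ) ≤ k := mod_cast hk
  exact_mod_cast (by linarith : (0 : ℝ) < (goodShifts G k δ E σ p).card)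

theorem IsNet.pairwise_of_subset (hC : IsNet G (3 * k) C) (hE : E ⊆ C) :
    E.Pairwise fun p q => q ∉ ballSet G p (2 * k) :=
  (hC.separated.mono hE).imp fun _ _ h hq => h (ballSet_mono (by omega) hq)

/-- The shift of each center, selected by the seed of its label among the good shifts relative to
the earlier centers. -/
noncomputable def shift [WellFoundedLT L] (G : SimpleGraph V) (k : ℕ) (δ : ℝ) (C : Set V)
    (φ : V → L) (ω : L → Selector (Fin k)) (p : V) : ℕ :=
  (ω (φ p) (goodShifts G k δ (earlierCenters C φ p)
    (fun q => if _h : φ q < φ p then shift G k δ C φ ω q else 0) p)).1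
termination_by wellFounded_lt.wrap (φ p)
decreasing_by all_goals exact _h

variable [WellFoundedLT L] {ω ω' : L → Selector (Fin k)}

theorem shift_eq (ω : L → Selector (Fin k)) (p : V) :
    shift G k δ C φ ω p =
      (ω (φ p) (goodShifts G k δ (earlierCenters C φ p) (shift G k δ C φ ω) p)).1 := by
  rw [shift, goodShifts_congr]
  exact fun q hq => dif_pos hq.2

theorem shift_lt (ω : L → Selector (Fin k)) (p : V) : shift G k δ C φ ω p < k := by
  rw [shift_eq]
  exact Fin.is_lt _

theorem shift_congr (p : V) (h : ∀ l ≤ φ p, ω l = ω' l) :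
    shift G k δ C φ ω p = shift G k δ C φ ω' p := by
  have hσ : Set.EqOn (shift G k δ C φ ω) (shift G k δ C φ ω') (earlierCenters C φ p) :=
    fun q hq => shift_congr q fun l hl => h l (hl.trans hq.2.le)
  rw [shift_eq, shift_eq, goodShifts_congr hσ, h _ le_rfl]
termination_by wellFounded_lt.wrap (φ p)
decreasing_by exact hq.2

theorem ncard_centerConflict_le (hG : IsDoubling D G) (hD : 0 < D) (hk : 1 ≤ k) (hδ : 0 < δ)
    (hkδ : 10 * D ^ 4 ≤ δ * k) (hC : IsNet G (3 * k) C) (ω : L → Selector (Fin k)) (c : V) :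
    ((centerConflict G k C (shift G k δ C φ ω) φ c).ncard : ℝ) ≤
      δ * (ballSet G c (4 * k)).ncard := by
  have hmem := (ω (φ c) _).2 <|
    hG.goodShifts_nonempty hD hk (hC.pairwise_of_subset (earlierCenters_subset φ c)) hδ hkδ
      (shift G k δ C φ ω) c
  rw [goodShifts, Finset.mem_filter_univ] at hmem
  rwa [centerConflict, shift_eq ω c]

theorem ncard_centerConflict_seeds_le [Finite L] (hG : IsDoubling D G) (hD : 0 < D) (hk : 1 ≤ k)
    (hδ : 0 < δ) (hkδ : 10 * D ^ 4 ≤ δ * k) (hC : IsNet G (3 * k) C) (x c : V) :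
    ({ω | x ∈ centerConflict G k C (shift G k δ C φ ω) φ c}.ncard : ℝ) ≤
      10 * D ^ 4 / k * Nat.card (L → Selector (Fin k)) := by
  have : NeZero k := ⟨by omega⟩
  refine ncard_le_mul_card_of_update (φ c) fun ω => ?_
  set σ := shift G k δ C φ ω
  set E := earlierCenters C φ c
  set S := goodShifts G k δ E σ c
  have hpw := hC.pairwise_of_subset (earlierCenters_subset φ c)
  have hcard := hG.le_two_mul_card_goodShifts hD hk hpw hδ hkδ σ c
  have hupdate (s : Selector (Fin k)) :
      Set.EqOn (shift G k δ C φ (Function.update ω (φ c) s)) σ E := fun q hq =>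
    shift_congr q fun l hl => Function.update_of_ne (hl.trans_lt hq.2).ne _ _
  have hfibre : {s | Function.update ω (φ c) s ∈
      {ω | x ∈ centerConflict G k C (shift G k δ C φ ω) φ c}} =
      {s | (s S).1 ∈ {t : Fin k | x ∈ conflict G k E σ c t}} := by
    ext s
    simp only [Set.mem_ofPred_eq, centerConflict]
    rw [conflict_congr (hupdate s), shift_eq, goodShifts_congr (hupdate s), Function.update_self]
  rw [hfibre]
  refine (Selector.ncard_apply_mem_le
    (hG.goodShifts_nonempty hD hk hpw hδ hkδ σ c) _).trans ?_
  refine mul_le_mul_of_nonneg_right ?_ (Nat.cast_nonneg _)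
  have : (0 : ℝ) < k := mod_cast hk
  calc ({t : Fin k | x ∈ conflict G k E σ c t}.ncard : ℝ) / S.card
      ≤ 5 * D ^ 4 / (k / 2) :=
        div_le_div₀ (by positivity) (hG.ncard_conflict_shifts_le hD hk hpw c x) (by positivity)
          (by linarith)
    _ = 10 * D ^ 4 / k := by field_simp; norm_num

end Shifts

section BoundaryBounds

variable {V L : Type} [LinearOrder L] [WellFoundedLT L] {G : SimpleGraph V} {k : ℕ} {δ D : ℝ}
  {C : Set V} {φ : V → L} {p : V}

theorem ncard_boundary_cell_le (hG : IsDoubling D G) (hD : 0 < D) (hk : 1 ≤ k) (hδ : 0 < δ)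
    (hkδ : 10 * D ^ 4 ≤ δ * k) (hC : IsNet G (3 * k) C) (hφ : Separating G (32 * k) φ)
    (ω : L → Selector (Fin k)) (hp : p ∈ C) :
    ((boundary G (cell G k C (shift G k δ C φ ω) φ p)).ncard : ℝ) ≤
      δ * D ^ 9 * (cell G k C (shift G k δ C φ ω) φ p).ncard := by
  set σ := shift G k δ C φ ω
  have hσ : ∀ q, σ q < k := shift_lt ω
  have hcell_fin : (cell G k C σ φ p).Finite :=
    (hG.finite_ballSet p (4 * k)).subset fun x hx => mem_ballSet_comm.1 hx.1.2
  have hN_fin : (C ∩ ballSet G p (8 * k)).Finite := (hG.finite_ballSet p _).inter_of_right _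
  have hsub : boundary G (cell G k C σ φ p) ⊆
      ⋃ c ∈ C ∩ ballSet G p (8 * k), centerConflict G k C σ φ c := fun x hx => by
    obtain ⟨c, hc, hxc⟩ := exists_mem_centerConflict_of_mem_boundary hC hσ hφ hx
    exact Set.mem_biUnion ⟨hc, mem_ballSet_trans (mem_ballSet_comm.1 hx.1.1.2)
      (mem_ballSet_comm.1 hxc.1) (by omega)⟩ hxc
  have hconflict : ∀ c ∈ C ∩ ballSet G p (8 * k),
      ((centerConflict G k C σ φ c).ncard : ℝ) ≤ δ * (D ^ 4 * (cell G k C σ φ p).ncard) :=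
    fun c ⟨_, hc⟩ => calc
      ((centerConflict G k C σ φ c).ncard : ℝ) ≤ δ * (ballSet G c (4 * k)).ncard :=
        ncard_centerConflict_le hG hD hk hδ hkδ hC ω c
      _ ≤ δ * (ballSet G p (2 ^ 4 * k)).ncard := by
        gcongr
        · exact hG.finite_ballSet p _
        · exact ballSet_subset_ballSet hc (by omega)
      _ ≤ δ * (D ^ 4 * (ballSet G p k).ncard) := by
        gcongr
        exact hG.ncard_ballSet_le_pow hD.le hk p 4
      _ ≤ δ * (D ^ 4 * (cell G k C σ φ p).ncard) := by
        gcongr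
        exact ballSet_subset_cell hC hσ hp
  calc ((boundary G (cell G k C σ φ p)).ncard : ℝ)
      ≤ (⋃ c ∈ C ∩ ballSet G p (8 * k), centerConflict G k C σ φ c).ncard :=
        mod_cast Set.ncard_le_ncard hsub
          (hN_fin.biUnion fun c _ => (hG.finite_ballSet c _).subset fun x hx => hx.1)
    _ ≤ (C ∩ ballSet G p (8 * k)).ncard * (δ * (D ^ 4 * (cell G k C σ φ p).ncard)) :=
        ncard_biUnion_le_mul hN_fin hconflict
    _ ≤ D ^ 5 * (δ * (D ^ 4 * (cell G k C σ φ p).ncard)) := by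
        gcongr
        exact hG.ncard_inter_ballSet_le hD hk (hC.pairwise_of_subset subset_rfl) (by omega) p
    _ = δ * D ^ 9 * (cell G k C σ φ p).ncard := by ring

theorem ncard_boundary_seeds_le [Finite L] (hG : IsDoubling D G) (hD : 0 < D) (hk : 1 ≤ k)
    (hδ : 0 < δ) (hkδ : 10 * D ^ 4 ≤ δ * k) (hC : IsNet G (3 * k) C)
    (hφ : Separating G (32 * k) φ) (x : V) :
    ({ω | ∃ p, x ∈ boundary G (cell G k C (shift G k δ C φ ω) φ p)}.ncard : ℝ) ≤
      10 * D ^ 8 / k * Nat.card (L → Selector (Fin k)) := by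
  have hN_fin : (C ∩ ballSet G x (4 * k)).Finite := (hG.finite_ballSet x _).inter_of_right _
  have hsub : {ω | ∃ p, x ∈ boundary G (cell G k C (shift G k δ C φ ω) φ p)} ⊆
      ⋃ c ∈ C ∩ ballSet G x (4 * k), {ω | x ∈ centerConflict G k C (shift G k δ C φ ω) φ c} :=
    fun ω ⟨p, hx⟩ => by
      obtain ⟨c, hc, hxc⟩ := exists_mem_centerConflict_of_mem_boundary hC (shift_lt ω) hφ hx
      exact Set.mem_biUnion ⟨hc, mem_ballSet_comm.1 hxc.1⟩ hxc
  calc ({ω | ∃ p, x ∈ boundary G (cell G k C (shift G k δ C φ ω) φ p)}.ncard : ℝ)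
      ≤ _ := mod_cast Set.ncard_le_ncard hsub
    _ ≤ (C ∩ ballSet G x (4 * k)).ncard * (10 * D ^ 4 / k * Nat.card (L → Selector (Fin k))) :=
        ncard_biUnion_le_mul hN_fin
          fun c _ => ncard_centerConflict_seeds_le hG hD hk hδ hkδ hC x c
    _ ≤ D ^ 4 * (10 * D ^ 4 / k * Nat.card (L → Selector (Fin k))) := by
        gcongr
        exact hG.ncard_inter_ballSet_le hD hk (hC.pairwise_of_subset subset_rfl) (by omega) x
    _ = 10 * D ^ 8 / k * Nat.card (L → Selector (Fin k)) := by ring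

end BoundaryBounds

section Locality

variable {V W : Type} {G : SimpleGraph V} {H : SimpleGraph W} (e : H ↪g G)

theorem map_mem_ballSet_iff {y z : W} {r : ℕ} (h : ballSet G (e y) r ⊆ Set.range e) :
    e z ∈ ballSet G (e y) r ↔ z ∈ ballSet H y r := by
  induction r generalizing z with
  | zero => simp only [ballSet_zero, Set.mem_singleton_iff, e.injective.eq_iff]
  | succ r ih =>
    have hr : ballSet G (e y) r ⊆ Set.range e := (ballSet_mono r.le_succ).trans h
    simp only [ballSet_succ, Set.mem_iUnion, Set.mem_insert_iff, SimpleGraph.mem_neighborSet,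
      exists_prop]
    constructor
    · rintro ⟨w, hw, hwz⟩
      obtain ⟨w, rfl⟩ := hr hw
      exact ⟨w, (ih hr).1 hw, hwz.imp (fun h => e.injective h) e.map_adj_iff.1⟩
    · rintro ⟨w, hw, hwz⟩
      exact ⟨e w, (ih hr).2 hw, hwz.imp (congrArg e) e.map_adj_iff.2⟩

theorem image_ballSet {y : W} {r : ℕ} (h : ballSet G (e y) r ⊆ Set.range e) :
    e '' ballSet H y r = ballSet G (e y) r := by
  rw [← Set.image_preimage_eq_of_subset h]
  congr 1
  ext z
  exact (map_mem_ballSet_iff e h).symm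

theorem dist_map_eq {y z : W} {r : ℕ} (h : ballSet G (e y) r ⊆ Set.range e)
    (hz : z ∈ ballSet H y r) : G.dist (e y) (e z) = H.dist y z := by
  obtain ⟨hreach, hle⟩ := mem_ballSet_iff_dist.1 hz
  obtain ⟨hreach', hle'⟩ := mem_ballSet_iff_dist.1 ((map_mem_ballSet_iff e h).2 hz)
  refine le_antisymm (dist_le_of_mem_ballSet ?_) (dist_le_of_mem_ballSet ?_)
  · exact (map_mem_ballSet_iff e ((ballSet_mono hle).trans h)).2
      (mem_ballSet_iff_dist.2 ⟨hreach, le_rfl⟩)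
  · exact (map_mem_ballSet_iff e ((ballSet_mono hle').trans h)).1
      (mem_ballSet_iff_dist.2 ⟨hreach', le_rfl⟩)

section CellTransfer

variable {L : Type} [LinearOrder L] {k : ℕ} {C E : Set V} {C' E' : Set W} {σ : V → ℕ}
  {σ' : W → ℕ}

theorem image_conflict {p : W} (h : ballSet G (e p) (8 * k) ⊆ Set.range e)
    (hE : ∀ q ∈ ballSet H p (8 * k), e q ∈ E ↔ q ∈ E')
    (hσ : ∀ q ∈ ballSet H p (8 * k), q ∈ E' → σ (e q) = σ' q) (t : ℕ) :
    e '' conflict H k E' σ' p t = conflict G k E σ (e p) t := by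
  have hp : ballSet G (e p) (4 * k) ⊆ Set.range e := (ballSet_mono (by omega)).trans h
  have hball {x : W} (hx : x ∈ ballSet H p (4 * k)) : ballSet G (e x) (4 * k) ⊆ Set.range e :=
    (ballSet_subset_ballSet ((map_mem_ballSet_iff e hp).2 hx) (by omega)).trans h
  have hdist_p {x : W} (hx : x ∈ ballSet H p (4 * k)) : G.dist (e x) (e p) = H.dist x p := by
    rw [G.dist_comm, H.dist_comm, dist_map_eq e hp hx]
  ext x
  constructor
  · rintro ⟨x, ⟨hx, q, hq, hqx, htie⟩, rfl⟩
    have hqp : q ∈ ballSet H p (8 * k) := mem_ballSet_trans hx hqx (by omega)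
    refine ⟨(map_mem_ballSet_iff e hp).2 hx, e q, (hE q hqp).2 hq,
      (map_mem_ballSet_iff e (hball hx)).2 hqx, ?_⟩
    rwa [hσ q hqp hq, hdist_p hx, dist_map_eq e (hball hx) hqx]
  · rintro ⟨hx, q, hq, hqx, htie⟩
    obtain ⟨x, rfl⟩ := hp hx
    rw [map_mem_ballSet_iff e hp] at hx
    obtain ⟨q, rfl⟩ := hball hx hqx
    rw [map_mem_ballSet_iff e (hball hx)] at hqx
    have hqp : q ∈ ballSet H p (8 * k) := mem_ballSet_trans hx hqx (by omega)
    rw [hE q hqp] at hq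
    rw [hσ q hqp hq, hdist_p hx, dist_map_eq e (hball hx) hqx] at htie
    exact ⟨x, ⟨hx, q, hq, hqx, htie⟩, rfl⟩

theorem goodShifts_map_eq {δ : ℝ} {p : W} (h : ballSet G (e p) (8 * k) ⊆ Set.range e)
    (hE : ∀ q ∈ ballSet H p (8 * k), e q ∈ E ↔ q ∈ E')
    (hσ : ∀ q ∈ ballSet H p (8 * k), q ∈ E' → σ (e q) = σ' q) :
    goodShifts G k δ E σ (e p) = goodShifts H k δ E' σ' p := by
  simp only [goodShifts, ← image_conflict e h hE hσ,
    ← image_ballSet e ((ballSet_mono (by omega : 4 * k ≤ 8 * k)).trans h),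
    Set.ncard_image_of_injective _ e.injective]

theorem cellLabel_map_eq {φ : V → L} {x : W} (h : ballSet G (e x) (4 * k) ⊆ Set.range e)
    (hC : ∀ q ∈ ballSet H x (4 * k), e q ∈ C ↔ q ∈ C')
    (hσ : ∀ q ∈ ballSet H x (4 * k), q ∈ C' → σ (e q) = σ' q) :
    cellLabel G k C σ φ (e x) = cellLabel H k C' σ' (φ ∘ e) x := by
  have hcenters (q : W) :
      e q ∈ C ∩ ballSet G (e x) (4 * k) ↔ q ∈ C' ∩ ballSet H x (4 * k) := by
    rw [Set.mem_inter_iff, map_mem_ballSet_iff e h]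
    exact and_congr_left (hC q)
  have hkey {q : W} (hq : q ∈ C' ∩ ballSet H x (4 * k)) :
      G.dist (e x) (e q) + σ (e q) = H.dist x q + σ' q := by
    rw [dist_map_eq e h hq.2, hσ q hq.2 hq.1]
  have howner : {p | e x ∈ cell G k C σ φ p} = e '' {p | x ∈ cell H k C' σ' (φ ∘ e) p} := by
    ext p
    constructor
    · rintro ⟨hp, hmin⟩
      obtain ⟨p, rfl⟩ := h hp.2
      rw [hcenters] at hp
      refine ⟨p, ⟨hp, fun q hq => ?_⟩, rfl⟩
      rw [← hkey hp, ← hkey hq]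
      exact hmin _ ((hcenters q).2 hq)
    · rintro ⟨p, ⟨hp, hmin⟩, rfl⟩
      refine ⟨(hcenters p).2 hp, fun q hq => ?_⟩
      obtain ⟨q, rfl⟩ := h hq.2
      rw [hcenters] at hq
      rw [hkey hp, hkey hq]
      exact hmin q hq
  rw [cellLabel, cellLabel, howner, Set.image_comp]

end CellTransfer

/-- The label of the owner of `x` in the partition into cells of the greedy `3 * k`-net, with the
shifts selected by the seeds `ω`. -/
noncomputable def seededCellLabel {V L : Type} [LinearOrder L] [WellFoundedLT L]
    (G : SimpleGraph V) (k : ℕ) (δ : ℝ) (φ : V → L) (ω : L → Selector (Fin k)) (x : V) : Set L :=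
  cellLabel G k (greedyNet G (3 * k) φ) (shift G k δ (greedyNet G (3 * k) φ) φ ω) φ x

variable {m k : ℕ} {δ : ℝ} {φ : V → Fin m}

theorem map_mem_greedyNet_iff {r : ℕ} {p : W}
    (h : ballSet G (e p) ((φ (e p) + 1) * r) ⊆ Set.range e) :
    e p ∈ greedyNet G r φ ↔ p ∈ greedyNet H r (φ ∘ e) := by
  have hp : ballSet G (e p) r ⊆ Set.range e :=
    (ballSet_mono (Nat.le_mul_of_pos_left r (Nat.succ_pos _))).trans h
  have ih {q : W} (hq : q ∈ ballSet H p r) (hlt : φ (e q) < φ (e p)) :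
      e q ∈ greedyNet G r φ ↔ q ∈ greedyNet H r (φ ∘ e) := by
    refine map_mem_greedyNet_iff
      ((ballSet_subset_ballSet ((map_mem_ballSet_iff e hp).2 hq) ?_).trans h)
    have := Nat.mul_le_mul_right r (Nat.succ_le_of_lt (Fin.lt_def.1 hlt))
    linarith
  rw [mem_greedyNet_iff, mem_greedyNet_iff]
  constructor
  · exact fun hG q hq hlt hnet =>
      hG (e q) ((map_mem_ballSet_iff e hp).2 hq) hlt ((ih hq hlt).2 hnet)
  · intro hH q hq hlt hnet
    obtain ⟨q, rfl⟩ := hp hq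
    rw [map_mem_ballSet_iff e hp] at hq
    exact hH q hq hlt ((ih hq hlt).1 hnet)
termination_by φ (e p)

/-- Each step of the recursion moves by at most `8 * k` and decreases the label. -/
theorem shift_map_eq {ω : Fin m → Selector (Fin k)} {p : W}
    (h : ballSet G (e p) ((φ (e p) + 1) * (8 * k)) ⊆ Set.range e) :
    shift G k δ (greedyNet G (3 * k) φ) φ ω (e p) =
      shift H k δ (greedyNet H (3 * k) (φ ∘ e)) (φ ∘ e) ω p := by
  have hp : ballSet G (e p) (8 * k) ⊆ Set.range e :=
    (ballSet_mono (Nat.le_mul_of_pos_left _ (Nat.succ_pos _))).trans h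
  have hball {q : W} (hq : q ∈ ballSet H p (8 * k)) (hlt : φ (e q) < φ (e p)) :
      ballSet G (e q) ((φ (e q) + 1) * (8 * k)) ⊆ Set.range e := by
    refine (ballSet_subset_ballSet ((map_mem_ballSet_iff e hp).2 hq) ?_).trans h
    have := Nat.mul_le_mul_right (8 * k) (Nat.succ_le_of_lt (Fin.lt_def.1 hlt))
    linarith
  rw [shift_eq, shift_eq, goodShifts_map_eq e hp]
  · rfl
  · refine fun q hq => and_congr_left fun hlt => map_mem_greedyNet_iff e ?_
    exact (ballSet_mono (Nat.mul_le_mul_left _ (by omega))).trans (hball hq hlt)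
  · exact fun q hq hqE => shift_map_eq (hball hq hqE.2)
termination_by φ (e p)
decreasing_by exact hqE.2

theorem seededCellLabel_map_eq {ω : Fin m → Selector (Fin k)} {x : W}
    (h : ballSet G (e x) (4 * k + m * (8 * k)) ⊆ Set.range e) :
    seededCellLabel G k δ φ ω (e x) = seededCellLabel H k δ (φ ∘ e) ω x := by
  have hx : ballSet G (e x) (4 * k) ⊆ Set.range e := (ballSet_mono (by omega)).trans h
  have hball {q : W} (hq : q ∈ ballSet H x (4 * k)) :
      ballSet G (e q) ((φ (e q) + 1) * (8 * k)) ⊆ Set.range e :=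
    (ballSet_subset_ballSet ((map_mem_ballSet_iff e hx).2 hq)
      (Nat.add_le_add_left (Nat.mul_le_mul_right _ (φ (e q)).is_lt) _)).trans h
  refine cellLabel_map_eq e hx (fun q hq => map_mem_greedyNet_iff e ?_)
    fun q hq _ => shift_map_eq e (hball hq)
  exact (ballSet_mono (Nat.mul_le_mul_left _ (by omega))).trans (hball hq)

/-- The oracle reading off `seededCellLabel` at the root of a ball. -/
noncomputable def cellOracle (d n s : ℕ) {m k : ℕ} (δ : ℝ) (ω : Fin m → Selector (Fin k)) :
    U d n s (Fin m) → Set (Fin m) :=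
  Quotient.lift (fun B => seededCellLabel B.graph k δ B.label ω B.root) <| by
    rintro B B' ⟨e, hroot, hlabel⟩
    have hcomp : B'.label ∘ e = B.label := funext hlabel
    change seededCellLabel B.graph k δ B.label ω B.root =
      seededCellLabel B'.graph k δ B'.label ω B'.root
    rw [← hroot, ← hcomp]
    exact (seededCellLabel_map_eq e.toEmbedding fun y _ => e.surjective y).symm

theorem algorithm_cellOracle {d n s : ℕ} (G : Gr d) {φ : G.V → Fin m}
    (hφ : Separating G.graph s φ) (hn : 4 * k + m * (8 * k) ≤ n) (ω : Fin m → Selector (Fin k)) :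
    algorithm (cellOracle d n s δ ω) G hφ = seededCellLabel G.graph k δ φ ω := by
  ext1 x
  refine (seededCellLabel_map_eq (x := ⟨x, self_mem_ballSet G.graph x n⟩)
    (SimpleGraph.Embedding.induce (ballSet G.graph x n)) fun y hy => ?_).symm
  exact ⟨⟨y, ballSet_mono hn hy⟩, rfl⟩

end Locality

section Oracles

variable {d k m n : ℕ} {δ ε D : ℝ}

theorem exists_partOf_cellOracle_eq_cell (hn : 4 * k + m * (8 * k) ≤ n) {G : Gr d}
    {φ : G.V → Fin m} (hφ : Separating G.graph (32 * k) φ) (ω : Fin m → Selector (Fin k))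
    (x : G.V) :
    ∃ p ∈ greedyNet G.graph (3 * k) φ,
      partOf G.graph (8 * k) (algorithm (cellOracle d n (32 * k) δ ω) G hφ) x =
        cell G.graph k (greedyNet G.graph (3 * k) φ)
          (shift G.graph k δ (greedyNet G.graph (3 * k) φ) φ ω) φ p := by
  have hC := isNet_greedyNet (hφ.mono (r := 3 * k) (by omega))
  obtain ⟨p, hx⟩ := exists_mem_cell (k := k) (φ := φ)
    (σ := shift G.graph k δ (greedyNet G.graph (3 * k) φ) φ ω) hC x
  rw [algorithm_cellOracle G hφ hn ω]
  exact ⟨p, hx.1.1, partOf_cellLabel_eq hC hφ hx⟩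

theorem isPartitioningOracle_cellOracle (hD : 0 < D) (hk : 1 ≤ k) (hδ : 0 < δ)
    (hkδ : 10 * D ^ 4 ≤ δ * k) (hδε : δ * D ^ 9 ≤ ε) (hn : 4 * k + m * (8 * k) ≤ n)
    (ω : Fin m → Selector (Fin k)) :
    IsPartitioningOracle {G : Gr d | IsDoubling D G.graph} ε (8 * k)
      (cellOracle d n (32 * k) δ ω) := by
  intro G hG φ hφ
  have hC := isNet_greedyNet (hφ.mono (r := 3 * k) (by omega))
  refine ⟨fun x y h => ?_, fun x => ?_⟩
  · rw [algorithm_cellOracle G hφ hn ω] at h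
    exact edist_le_or_le_of_cellLabel_eq hC hφ h
  · obtain ⟨p, hp, hpart⟩ := exists_partOf_cellOracle_eq_cell (δ := δ) hn hφ ω x
    rw [hpart, isoperimetric]
    refine div_le_of_le_mul₀ (Nat.cast_nonneg _) ((by positivity : 0 ≤ δ * D ^ 9).trans hδε) ?_
    refine (ncard_boundary_cell_le hG hD hk hδ hkδ hC hφ ω hp).trans ?_
    gcongr

theorem ncard_boundary_partOf_seeds_le (hD : 0 < D) (hk : 1 ≤ k) (hδ : 0 < δ)
    (hkδ : 10 * D ^ 4 ≤ δ * k) (hn : 4 * k + m * (8 * k) ≤ n) {G : Gr d}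
    (hG : IsDoubling D G.graph) {φ : G.V → Fin m} (hφ : Separating G.graph (32 * k) φ) (x : G.V) :
    ({ω : Fin m → Selector (Fin k) | x ∈ boundary G.graph
      (partOf G.graph (8 * k) (algorithm (cellOracle d n (32 * k) δ ω) G hφ) x)}.ncard : ℝ) ≤
      10 * D ^ 8 / k * Nat.card (Fin m → Selector (Fin k)) := by
  have hC := isNet_greedyNet (hφ.mono (r := 3 * k) (by omega))
  refine le_trans (Nat.cast_le.2 <| Set.ncard_le_ncard fun ω hω => ?_)
    (ncard_boundary_seeds_le hG hD hk hδ hkδ hC hφ x)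
  obtain ⟨p, -, hpart⟩ := exists_partOf_cellOracle_eq_cell (δ := δ) hn hφ ω x
  rw [Set.mem_ofPred_eq, hpart] at hω
  exact ⟨p, hω⟩

theorem exists_scale (hD : 1 < D) (hε : 0 < ε) :
    ∃ k : ℕ, 1 ≤ k ∧ 10 * D ^ 4 ≤ ε / D ^ 9 * k ∧ 10 * D ^ 8 / k ≤ ε := by
  have : 0 < D := one_pos.trans hD
  obtain ⟨k, hk⟩ := exists_nat_ge (10 * D ^ 13 / ε)
  have hk0 : (0 : ℝ) < k := lt_of_lt_of_le (by positivity) hk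
  rw [div_le_iff₀ hε] at hk
  refine ⟨k, mod_cast hk0, ?_, ?_⟩
  · rw [div_mul_eq_mul_div, le_div_iff₀ (by positivity)]
    linarith
  · rw [div_le_iff₀ hk0, mul_comm ε]
    refine le_trans ?_ hk
    gcongr <;> linarith

end Oracles

end QualitativeGraphs

open QualitativeGraphs

theorem mainTheorem1 (d : ℕ) (D : ℝ) (hD : 1 < D) :
    QualitativeGraphs.DistributedStronglyAlmostFinite
      {G : QualitativeGraphs.Gr d | QualitativeGraphs.IsDoubling D G.graph} := by
  intro ε hε
  have hD0 : 0 < D := one_pos.trans hD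
  obtain ⟨k, hk, hkδ, hkε⟩ := exists_scale hD hε
  have : NeZero k := ⟨by omega⟩
  let m := (d + 1) ^ (32 * k)
  let n := 4 * k + m * (8 * k) + 32 * k
  have hn : 4 * k + m * (8 * k) ≤ n := Nat.le_add_right _ _
  have hδ : 0 < ε / D ^ 9 := by positivity
  let e := (Finite.equivFin (Fin m → Selector (Fin k))).symm
  refine ⟨32 * k, n, Nat.card (Fin m → Selector (Fin k)), 8 * k, by omega, by omega,
    Nat.card_pos, by omega, Fin m, Set (Fin m), inferInstance, inferInstance,
    isLarge_fin d _, fun i => cellOracle d n (32 * k) (ε / D ^ 9) (e i), fun i => ?_,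
    fun G hG φ hφ x => ?_⟩
  · exact isPartitioningOracle_cellOracle hD0 hk hδ hkδ
      (div_mul_cancel₀ ε (by positivity)).le hn (e i)
  · refine div_le_of_le_mul₀ (Nat.cast_nonneg _) hε.le ?_
    have hseeds := ncard_boundary_partOf_seeds_le hD0 hk hδ hkδ hn hG hφ x
    rw [← Set.ncard_image_of_injective _ e.symm.injective, e.symm.image_eq_preimage_symm] at hseeds
    exact hseeds.trans (by gcongr)
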